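/- \textbf{Theorem (Strong duality).} Let $\mathcal X$ and $\mathcal Y$ be compact metric spaces (for instance compact convex sets), let $\mu$ and $\nu$ be Borel probability measures on $\mathcal X$ and $\mathcal Y$, and let $c, m : \mathcal X \times \mathcal Y \to \mathbb R$ be continuous with $\inf_{x,y} m(x,y) > 0$. Let $\Gamma_m(\mu,\nu)$ be the set of all Borel probability measures $\pi$ on $\mathcal X\times\mathcal Y$ such that $$\pi(A\times\mathcal Y)=\mu(A)\quad\text{and}\quad \frac{\int_{\mathcal X\times B} m\,d\pi}{\int_{\mathcal X\times\mathcal Y} m\,d\pi}=\nu(B)$$ for all Borel sets $A\subseteq\mathcal X$ and $B\subseteq\mathcal Y$. Let $\mathcal A(c,m)$ be the set of all pairs of continuous functions $\varphi:\mathcal X\to\mathbb R$, $\psi:\mathcal Y\to\mathbb R$ such that $$c(x,y)\ \ge\ \varphi(x)+\Bigl(\psi(y)-\int_{\mathcal Y}\psi\,d\nu\Bigr)\,m(x,y)\qquad\text{for all }(x,y)\in\mathcal X\times\mathcal Y.$$ Then $$\inf_{\pi\in\Gamma_m(\mu,\nu)}\int_{\mathcal X\times\mathcal Y} c\,d\pi\;=\;\sup_{(\varphi,\psi)\in\mathcal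 A(c,m)}\int_{\mathcal X}\varphi\,d\mu ,$$ where the infimum and the supremum are taken in the extended real numbers. -/

import Mathlib

open MeasureTheory

noncomputable section

namespace NonConservativeOT

variable {X Y : Type*} [MeasurableSpace X] [MeasurableSpace Y]

/-- The set `Γ_m(μ, ν)` of non-conservative transport plans: probability measures `π` on `X × Y`
whose first marginal is `μ` and such that the transported mass `B ↦ ∫_{X × B} m dπ`, normalised by
its total amount `∫ m dπ`, is `ν`. -/
def transportPlans (m : X × Y → ℝ) (μ : Measure X) (ν : Measure Y) : Set (Measure (X × Y)) :=
  {π | IsProbabilityMeasure π ∧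
    (∀ A : Set X, MeasurableSet A → π (A ×ˢ Set.univ) = μ A) ∧
    (∀ B : Set Y, MeasurableSet B →
      (∫ z in Set.univ ×ˢ B, m z ∂π) / (∫ z, m z ∂π) = (ν B).toReal)}

/-- The value `inf_{π ∈ Γ_m(μ, ν)} ∫ c dπ` of the non-conservative Kantorovich problem, in the
extended reals (so it is `⊤` if there is no plan). -/
def kantorovichValue (c m : X × Y → ℝ) (μ : Measure X) (ν : Measure Y) : EReal :=
  ⨅ π ∈ transportPlans m μ ν, ((∫ z, c z ∂π : ℝ) : EReal)

variable [TopologicalSpace X] [TopologicalSpace Y]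

/-- The set of admissible pairs `(φ, ψ) ∈ C(X) × C(Y)` of the dual problem. -/
def admissiblePairs (c m : X × Y → ℝ) (ν : Measure Y) : Set (C(X, ℝ) × C(Y, ℝ)) :=
  {p | ∀ (x : X) (y : Y), p.1 x + (p.2 y - ∫ b, p.2 b ∂ν) * m (x, y) ≤ c (x, y)}

/-- The value `sup ∫ φ dμ` over admissible pairs `(φ, ψ)` of the dual problem, in the extended
reals. -/
def dualValue (c m : X × Y → ℝ) (μ : Measure X) (ν : Measure Y) : EReal :=
  ⨆ p ∈ admissiblePairs c m ν, ((∫ x, p.1 x ∂μ : ℝ) : EReal)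

end NonConservativeOT

end

namespace NonConservativeOT

/-! The problem is a linear program over nonnegative measures on a compact space. Tested against
continuous functions, the plan conditions become linear equations `∫ L (φ, ψ) dπ = ∫ φ dμ`, where `L
(φ, ψ) = φ + (ψ - ∫ ψ dν) m` (`mem_transportPlans_iff`). Weak duality is then integration of the
dual constraint.

For the converse, `exists_measure_isLUB` applies Hahn–Banach to the cheapest cost of dominating a
function by some `L v`. The resulting functional is positive, so by Riesz it is a measure, and this
measure is an optimal plan. The required compatibility, that `L (φ, ψ) ≥ 0` implies `∫ φ dμ ≥ 0`,
holds because division by `m > 0` and integration against `ν` eliminate `ψ`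
(`nonneg_of_dualConstraint_nonneg`). -/

/-- A positive linear functional on `C(K, ℝ)`, for `K` compact Hausdorff, is the integral against a
finite measure. -/
theorem exists_measure_of_nonneg_functional {K : Type*} [TopologicalSpace K] [CompactSpace K]
    [T2Space K] [MeasurableSpace K] [BorelSpace K] (Λ : C(K, ℝ) →ₗ[ℝ] ℝ)
    (hΛ : ∀ f, 0 ≤ f → 0 ≤ Λ f) :
    ∃ π : Measure K, IsFiniteMeasure π ∧ ∀ f : C(K, ℝ), ∫ z, f z ∂π = Λ f := by
  let Λ' : CompactlySupportedContinuousMap K ℝ →ₗ[ℝ] ℝ :=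
    { toFun := fun f => Λ f.toContinuousMap
      map_add' := fun f g => Λ.map_add f.toContinuousMap g.toContinuousMap
      map_smul' := fun t f => Λ.map_smul t f.toContinuousMap }
  let P := PositiveLinearMap.mk₀ Λ' fun f hf => hΛ f.toContinuousMap hf
  refine ⟨RealRMK.rieszMeasure P, inferInstance, fun f => ?_⟩
  exact RealRMK.integral_rieszMeasure P (CompactlySupportedContinuousMap.continuousMapEquiv f)

/-- Strong duality for a linear program over the nonnegative measures on a compact space: if the
constraint map `L` is positively compatible with the right-hand side `ℓ` and its range contains the
constants, then the dual supremum is attained as the cost of a feasible measure. -/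
theorem exists_measure_isLUB {K V : Type*} [TopologicalSpace K] [CompactSpace K]
    [T2Space K] [MeasurableSpace K] [BorelSpace K] [AddCommGroup V] [Module ℝ V]
    (L : V →ₗ[ℝ] C(K, ℝ)) (l : V →ₗ[ℝ] ℝ) (hpos : ∀ v, 0 ≤ L v → 0 ≤ l v) (u : V) (hu : L u = 1)
    (c : C(K, ℝ)) :
    ∃ π : Measure K, IsFiniteMeasure π ∧ (∀ v, ∫ z, L v z ∂π = l v) ∧
      IsLUB (l '' {v | L v ≤ c}) (∫ z, c z ∂π) := by
  have hmono : ∀ v w, L v ≤ L w → l v ≤ l w := fun v w h => by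
    have := hpos (w - v) (by rwa [map_sub, sub_nonneg])
    rwa [map_sub, sub_nonneg] at this
  have hconst : ∀ (t : ℝ) (z : K), L (t • u) z = t := fun t z => by simp [hu]
  have hnorm : ∀ (f : C(K, ℝ)), f ≤ L (‖f‖ • u) := fun f z => by
    refine le_of_le_of_eq ?_ (hconst _ z).symm
    exact (le_abs_self _).trans (f.norm_coe_le_norm z)
  have hnorm' : ∀ (f : C(K, ℝ)), L ((-‖f‖) • u) ≤ f := fun f z => by
    refine le_of_eq_of_le (hconst _ z) ?_
    exact (abs_le.1 (f.norm_coe_le_norm z)).1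
  let S : C(K, ℝ) → Set ℝ := fun f => l '' {v | f ≤ L v}
  have hne : ∀ f, (S f).Nonempty := fun f => ⟨_, _, hnorm f, rfl⟩
  have hbdd : ∀ f, BddBelow (S f) := fun f => by
    refine ⟨l ((-‖f‖) • u), ?_⟩
    rintro _ ⟨v, hv, rfl⟩
    exact hmono _ _ ((hnorm' f).trans hv)
  -- The sublinear majorant for Hahn–Banach; domination by multiples of `u` makes it finite.
  let p : C(K, ℝ) → ℝ := fun f => sInf (S f)
  have hp_le : ∀ f v, f ≤ L v → p f ≤ l v := fun f v h => csInf_le (hbdd f) ⟨v, h, rfl⟩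
  have hp_L : ∀ v, p (L v) = l v := fun v => le_antisymm (hp_le _ _ le_rfl) <|
    le_csInf (hne _) <| by rintro _ ⟨w, hw, rfl⟩; exact hmono _ _ hw
  have hp_zero : p 0 = 0 := by simpa using hp_L 0
  have hp_add : ∀ f g, p (f + g) ≤ p f + p g := fun f g => by
    rw [← sub_le_iff_le_add]
    refine le_csInf (hne f) ?_
    rintro _ ⟨v, hv, rfl⟩
    rw [sub_le_iff_le_add, ← sub_le_iff_le_add']
    refine le_csInf (hne g) ?_
    rintro _ ⟨w, hw, rfl⟩
    rw [sub_le_iff_le_add', ← map_add]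
    exact hp_le _ _ (by rw [map_add]; exact add_le_add hv hw)
  have hp_smul_le : ∀ t : ℝ, 0 < t → ∀ f, t * p f ≤ p (t • f) := fun t ht f => by
    refine le_csInf (hne _) ?_
    rintro _ ⟨v, hv, rfl⟩
    rw [← le_inv_mul_iff₀ ht, ← smul_eq_mul, ← map_smul]
    refine hp_le _ _ fun z => ?_
    have hz : t * f z ≤ L v z := hv z
    rw [map_smul]
    exact (le_inv_mul_iff₀ ht).2 hz
  have hp_smul : ∀ t : ℝ, 0 < t → ∀ f, p (t • f) = t * p f := fun t ht f => by
    refine le_antisymm ?_ (hp_smul_le t ht f)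
    have h := hp_smul_le t⁻¹ (inv_pos.2 ht) (t • f)
    rw [inv_smul_smul₀ ht.ne'] at h
    exact (inv_mul_le_iff₀ ht).1 h
  -- Prescribing the value at `-c` forces the extension to satisfy `Λ c = -p (-c)`, which is the
  -- dual supremum.
  let F : C(K, ℝ) →ₗ.[ℝ] ℝ := LinearPMap.mkSpanSingleton' (-c) (p (-c)) fun t ht => by
    rcases smul_eq_zero.1 ht with h | h
    · simp [h]
    · simp [h, hp_zero]
  have hF : ∀ x : F.domain, F x ≤ p x := by
    rintro ⟨x, hx⟩
    obtain ⟨t, rfl⟩ := Submodule.mem_span_singleton.1 hx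
    have h1 : F ⟨t • (-c), hx⟩ = t * p (-c) := LinearPMap.mkSpanSingleton'_apply _ _ _ _ _
    rw [h1]
    change t * p (-c) ≤ p (t • (-c))
    rcases lt_trichotomy t 0 with ht | rfl | ht
    · have h2 := hp_add (t • (-c)) ((-t) • (-c))
      rw [← add_smul, add_neg_cancel, zero_smul, hp_zero, hp_smul (-t) (neg_pos.2 ht)] at h2
      linarith
    · simp [hp_zero]
    · exact (hp_smul t ht _).ge
  obtain ⟨Λ, hΛF, hΛp⟩ := exists_extension_of_le_sublinear F p hp_smul hp_add hF
  have hΛc : Λ c = -p (-c) := by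
    have h1 := hΛF ⟨-c, Submodule.mem_span_singleton_self _⟩
    have h2 : F ⟨-c, Submodule.mem_span_singleton_self _⟩ = p (-c) :=
      LinearPMap.mkSpanSingleton'_apply_self _ _ _ _
    rw [h2] at h1
    change Λ (-c) = _ at h1
    rw [map_neg] at h1
    linarith
  -- Since `p (L v) = l v`, the bound `Λ ≤ p` at `v` and `-v` gives both inequalities.
  have hΛL : ∀ v, Λ (L v) = l v := fun v => by
    have h1 := hΛp (L v)
    have h2 := hΛp (L (-v))
    rw [hp_L] at h1 h2
    rw [map_neg, map_neg, map_neg] at h2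
    linarith
  obtain ⟨π, hπ, hint⟩ := exists_measure_of_nonneg_functional Λ fun f hf => by
    have h1 := (hΛp (-f)).trans (hp_le (-f) 0 (by simpa using hf))
    rw [map_neg, map_zero] at h1
    linarith
  refine ⟨π, hπ, fun v => (hint _).trans (hΛL v), ?_⟩
  rw [hint c, hΛc]
  constructor
  · rintro _ ⟨v, hv, rfl⟩
    have h := hp_le (-c) (-v) (by rw [map_neg]; exact neg_le_neg hv)
    rw [map_neg] at h
    linarith
  · intro b hb
    rw [neg_le]
    refine le_csInf (hne _) ?_
    rintro _ ⟨v, hv, rfl⟩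
    have h := hb ⟨-v, by rw [Set.mem_ofPred_eq, map_neg]; exact neg_le.1 hv, rfl⟩
    rw [map_neg] at h
    linarith

theorem integrable_of_continuous {K : Type*} [TopologicalSpace K] [CompactSpace K] [T2Space K]
    [MeasurableSpace K] [BorelSpace K] {π : Measure K} [IsFiniteMeasure π] {f : K → ℝ}
    (hf : Continuous f) : Integrable f π := by
  simpa using hf.continuousOn.integrableOn_compact (μ := π) isCompact_univ

/-! ### Transport plans as linear constraints -/

section Transport

variable {X Y : Type*} [MeasurableSpace X] [MeasurableSpace Y]

/-- The image under `snd` of `m π`: the mass received by the subsets of `Y`. -/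
noncomputable def receivedMass (m : X × Y → ℝ) (π : Measure (X × Y)) : Measure Y :=
  (π.withDensity fun z => ENNReal.ofReal (m z)).map Prod.snd

theorem receivedMass_apply_toReal {m : X × Y → ℝ} (hm : Measurable m) (hm0 : ∀ z, 0 ≤ m z)
    (π : Measure (X × Y)) {B : Set Y} (hB : MeasurableSet B) :
    (receivedMass m π B).toReal = ∫ z in Set.univ ×ˢ B, m z ∂π := by
  have hpre : (Prod.snd ⁻¹' B : Set (X × Y)) = Set.univ ×ˢ B := by ext; simp
  rw [receivedMass, Measure.map_apply measurable_snd hB,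
    withDensity_apply _ (measurable_snd hB), hpre,
    integral_eq_lintegral_of_nonneg_ae (Filter.Eventually.of_forall hm0)
      hm.aestronglyMeasurable]

theorem integral_receivedMass {m : X × Y → ℝ} (hm : Measurable m) (hm0 : ∀ z, 0 ≤ m z)
    (π : Measure (X × Y)) {g : Y → ℝ} (hg : Measurable g) :
    ∫ y, g y ∂(receivedMass m π) = ∫ z, g z.2 * m z ∂π := by
  rw [receivedMass, integral_map measurable_snd.aemeasurable hg.aestronglyMeasurable,
    integral_withDensity_eq_integral_toReal_smul hm.ennreal_ofReal (by simp)]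
  refine integral_congr_ae (Filter.Eventually.of_forall fun z => ?_)
  simp [ENNReal.toReal_ofReal (hm0 z), mul_comm]

theorem isFiniteMeasure_receivedMass {m : X × Y → ℝ} {π : Measure (X × Y)}
    (hm : Integrable m π) : IsFiniteMeasure (receivedMass m π) := by
  have := isFiniteMeasure_withDensity_ofReal hm.2
  unfold receivedMass
  infer_instance

variable [MetricSpace X] [CompactSpace X] [BorelSpace X]
  [MetricSpace Y] [CompactSpace Y] [BorelSpace Y]

/-- The set equations defining a transport plan, tested against continuous functions. -/
theorem mem_transportPlans_iff {m : X × Y → ℝ} (hm : Continuous m) (hm0 : ∀ z, 0 < m z)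
    {μ : Measure X} [IsProbabilityMeasure μ] {ν : Measure Y} [IsProbabilityMeasure ν]
    {π : Measure (X × Y)} [IsFiniteMeasure π] :
    π ∈ transportPlans m μ ν ↔ (∀ φ : C(X, ℝ), ∫ z, φ z.1 ∂π = ∫ x, φ x ∂μ) ∧
      ∀ ψ : C(Y, ℝ), ∫ z, (ψ z.2 - ∫ y, ψ y ∂ν) * m z ∂π = 0 := by
  have hmi : Integrable m π := integrable_of_continuous hm
  have hm0' : ∀ z, 0 ≤ m z := fun z => (hm0 z).le
  have := isFiniteMeasure_receivedMass hmi
  have hMnn : 0 ≤ ∫ z, m z ∂π := integral_nonneg hm0'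
  have hM : IsProbabilityMeasure π → 0 < ∫ z, m z ∂π := fun h => by
    rw [integral_pos_iff_support_of_nonneg hm0' hmi]
    have : Function.support m = Set.univ := by ext z; simpa using (hm0 z).ne'
    simp [this]
  have hfst : (∀ A : Set X, MeasurableSet A → π (A ×ˢ Set.univ) = μ A) ↔
      ∀ φ : C(X, ℝ), ∫ z, φ z.1 ∂π = ∫ x, φ x ∂μ := by
    have hmap : ∀ φ : X → ℝ, Continuous φ → ∫ x, φ x ∂(π.map Prod.fst) = ∫ z, φ z.1 ∂π :=
      fun φ hφ => integral_map measurable_fst.aemeasurable hφ.measurable.aestronglyMeasurable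
    have hpre : ∀ A : Set X, (Prod.fst ⁻¹' A : Set (X × Y)) = A ×ˢ Set.univ := fun A => by
      ext; simp
    constructor
    · intro h φ
      have : π.map Prod.fst = μ := Measure.ext fun A hA => by
        rw [Measure.map_apply measurable_fst hA, hpre, h A hA]
      rw [← hmap φ φ.continuous, this]
    · intro h A hA
      have : π.map Prod.fst = μ := ext_of_forall_integral_eq_of_IsFiniteMeasure fun f =>
        (hmap f f.continuous).trans (h f.toContinuousMap)
      rw [← hpre, ← Measure.map_apply measurable_fst hA, this]
  -- Both sides say that `receivedMass m π = M • ν` with `M = ∫ m dπ`; positivity of `M` allows the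
  -- quotient to be cleared.
  have hsnd : IsProbabilityMeasure π → ((∀ B : Set Y, MeasurableSet B →
      (∫ z in Set.univ ×ˢ B, m z ∂π) / (∫ z, m z ∂π) = (ν B).toReal) ↔
      ∀ ψ : C(Y, ℝ), ∫ z, (ψ z.2 - ∫ y, ψ y ∂ν) * m z ∂π = 0) := fun hπ => by
    have hM := hM hπ
    have hsub : ∀ ψ : Y → ℝ, Continuous ψ → ∫ z, (ψ z.2 - ∫ y, ψ y ∂ν) * m z ∂π =
        (∫ y, ψ y ∂(receivedMass m π)) - (∫ y, ψ y ∂ν) * ∫ z, m z ∂π := fun ψ hψ => by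
      rw [integral_receivedMass hm.measurable hm0' π hψ.measurable, ← integral_const_mul,
        ← integral_sub (integrable_of_continuous (by fun_prop)) (hmi.const_mul _)]
      simp only [sub_mul]
    have hsmul : ∀ ψ : Y → ℝ, ∫ y, ψ y ∂(ENNReal.ofReal (∫ z, m z ∂π) • ν) =
        (∫ y, ψ y ∂ν) * ∫ z, m z ∂π := fun ψ => by
      rw [integral_smul_measure, ENNReal.toReal_ofReal hMnn, smul_eq_mul, mul_comm]
    have : IsFiniteMeasure (ENNReal.ofReal (∫ z, m z ∂π) • ν) :=
      Measure.smul_finite _ ENNReal.ofReal_ne_top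
    constructor
    · intro h ψ
      have heq : receivedMass m π = ENNReal.ofReal (∫ z, m z ∂π) • ν := Measure.ext fun B hB => by
        rw [← ENNReal.toReal_eq_toReal_iff' (measure_ne_top _ _) (measure_ne_top _ _),
          receivedMass_apply_toReal hm.measurable hm0' π hB, Measure.smul_apply, smul_eq_mul,
          ENNReal.toReal_mul, ENNReal.toReal_ofReal hMnn, ← h B hB, mul_div_cancel₀ _ hM.ne']
      rw [hsub ψ ψ.continuous, heq, hsmul, sub_self]
    · intro h B hB
      have heq : receivedMass m π = ENNReal.ofReal (∫ z, m z ∂π) • ν :=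
        ext_of_forall_integral_eq_of_IsFiniteMeasure fun f => by
          have := h f.toContinuousMap
          rw [hsub _ f.toContinuousMap.continuous, sub_eq_zero] at this
          exact this.trans (hsmul f).symm
      rw [← receivedMass_apply_toReal hm.measurable hm0' π hB, heq, Measure.smul_apply,
        smul_eq_mul, ENNReal.toReal_mul, ENNReal.toReal_ofReal hMnn, mul_div_cancel_left₀ _ hM.ne']
  constructor
  · rintro ⟨hπ, h1, h2⟩
    exact ⟨hfst.1 h1, (hsnd hπ).1 h2⟩
  · rintro ⟨h1, h2⟩
    -- The total mass is read off from the first marginal.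
    have hπ : IsProbabilityMeasure π := ⟨by
      have := hfst.2 h1 Set.univ MeasurableSet.univ
      rwa [Set.univ_prod_univ, measure_univ (μ := μ)] at this⟩
    exact ⟨hπ, hfst.2 h1, (hsnd hπ).2 h2⟩

end Transport

/-! ### Positivity of the dual constraint -/

section DualConstraint

variable {X Y : Type*} [MetricSpace X] [CompactSpace X]
  [MetricSpace Y] [CompactSpace Y] [MeasurableSpace Y] [BorelSpace Y]

/-- The map `(φ, ψ) ↦ φ(x) + (ψ(y) - ∫ ψ dν) m(x, y)` from the dual constraint. -/
noncomputable def dualConstraint (m : C(X × Y, ℝ)) (ν : Measure Y) [IsProbabilityMeasure ν] :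
    C(X, ℝ) × C(Y, ℝ) →ₗ[ℝ] C(X × Y, ℝ) where
  toFun p := ⟨fun z => p.1 z.1 + (p.2 z.2 - ∫ y, p.2 y ∂ν) * m z, by fun_prop⟩
  map_add' p q := by
    ext z
    have : ∫ y, (p.2 y + q.2 y) ∂ν = (∫ y, p.2 y ∂ν) + ∫ y, q.2 y ∂ν :=
      integral_add (integrable_of_continuous p.2.continuous)
        (integrable_of_continuous q.2.continuous)
    simp [this]
    ring
  map_smul' t p := by
    ext z
    simp [integral_const_mul]
    ring

theorem dualConstraint_apply (m : C(X × Y, ℝ)) (ν : Measure Y) [IsProbabilityMeasure ν]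
    (p : C(X, ℝ) × C(Y, ℝ)) (z : X × Y) :
    dualConstraint m ν p z = p.1 z.1 + (p.2 z.2 - ∫ y, p.2 y ∂ν) * m z := rfl

/-- If `φ(x) + (ψ(y) - ∫ ψ dν) m(x, y) ≥ 0` everywhere then `φ ≥ 0`: divide by `m(x, ·)` and
integrate against `ν`. -/
theorem nonneg_of_dualConstraint_nonneg {m : C(X × Y, ℝ)} (hm0 : ∀ z, 0 < m z)
    {ν : Measure Y} [IsProbabilityMeasure ν] {p : C(X, ℝ) × C(Y, ℝ)}
    (hp : 0 ≤ dualConstraint m ν p) (x : X) : 0 ≤ p.1 x := by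
  have hcont : Continuous fun y => (m (x, y))⁻¹ :=
    Continuous.inv₀ (by fun_prop) fun y => (hm0 (x, y)).ne'
  have hZi : Integrable (fun y => (m (x, y))⁻¹) ν := integrable_of_continuous hcont
  have hψi : Integrable (fun y => p.2 y) ν := integrable_of_continuous p.2.continuous
  have hZ : 0 < ∫ y, (m (x, y))⁻¹ ∂ν := by
    rw [integral_pos_iff_support_of_nonneg (fun y => (inv_pos.2 (hm0 (x, y))).le) hZi]
    have : (Function.support fun y => (m (x, y))⁻¹) = Set.univ := by
      ext y; simpa using (hm0 (x, y)).ne'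
    simp [this]
  have hnn : 0 ≤ ∫ y, (p.1 x * (m (x, y))⁻¹ + (p.2 y - ∫ b, p.2 b ∂ν)) ∂ν := by
    refine integral_nonneg fun y => ?_
    have hxy : 0 ≤ dualConstraint m ν p (x, y) := hp (x, y)
    have h := mul_nonneg hxy (inv_pos.2 (hm0 (x, y))).le
    rw [dualConstraint_apply, add_mul, mul_assoc (_ - _),
      mul_inv_cancel₀ (hm0 (x, y)).ne', mul_one] at h
    exact h
  have hsub : Integrable (fun y => p.2 y - ∫ b, p.2 b ∂ν) ν := hψi.sub (integrable_const _)
  rw [integral_add (hZi.const_mul _) hsub, integral_const_mul,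
    integral_sub hψi (integrable_const _)] at hnn
  simp only [integral_const, probReal_univ, one_smul, sub_self, add_zero] at hnn
  exact nonneg_of_mul_nonneg_left hnn hZ

end DualConstraint

end NonConservativeOT

/-! ### Strong duality -/

open NonConservativeOT in
theorem mainTheorem1 {X Y : Type*}
    [MetricSpace X] [CompactSpace X] [MeasurableSpace X] [BorelSpace X]
    [MetricSpace Y] [CompactSpace Y] [MeasurableSpace Y] [BorelSpace Y]
    (μ : Measure X) [IsProbabilityMeasure μ] (ν : Measure Y) [IsProbabilityMeasure ν]
    (c m : X × Y → ℝ) (hc : Continuous c) (hm : Continuous m)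
    (hm_pos : ∃ δ : ℝ, 0 < δ ∧ ∀ z : X × Y, δ ≤ m z) :
    NonConservativeOT.kantorovichValue c m μ ν = NonConservativeOT.dualValue c m μ ν := by
  obtain ⟨δ, hδ, hδm⟩ := hm_pos
  have hm0 : ∀ z, 0 < m z := fun z => hδ.trans_le (hδm z)
  let c' : C(X × Y, ℝ) := ⟨c, hc⟩
  let m' : C(X × Y, ℝ) := ⟨m, hm⟩
  let l : C(X, ℝ) × C(Y, ℝ) →ₗ[ℝ] ℝ :=
    { toFun := fun p => ∫ x, p.1 x ∂μ
      map_add' := fun p q => integral_add (integrable_of_continuous p.1.continuous)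
        (integrable_of_continuous q.1.continuous)
      map_smul' := fun t p => integral_const_mul t _ }
  have hplan : ∀ (π : Measure (X × Y)) [IsFiniteMeasure π] (p : C(X, ℝ) × C(Y, ℝ)),
      ∫ z, dualConstraint m' ν p z ∂π =
        (∫ z, p.1 z.1 ∂π) + ∫ z, (p.2 z.2 - ∫ y, p.2 y ∂ν) * m z ∂π := fun π _ p =>
    integral_add (integrable_of_continuous (by fun_prop)) (integrable_of_continuous (by fun_prop))
  apply le_antisymm
  · obtain ⟨π, hπ, hL, hlub⟩ := exists_measure_isLUB (dualConstraint m' ν) l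
      (fun p hp => integral_nonneg (nonneg_of_dualConstraint_nonneg hm0 hp)) (1, 0)
      (by ext z; simp [dualConstraint_apply]) c'
    have hmem : π ∈ transportPlans m μ ν := by
      refine (mem_transportPlans_iff hm hm0).2 ⟨fun φ => ?_, fun ψ => ?_⟩
      · have h := hL (φ, 0)
        rw [hplan] at h
        simpa [l] using h
      · have h := hL (0, ψ)
        rw [hplan] at h
        simpa [l] using h
    refine (iInf₂_le π hmem).trans ?_
    -- Comparing with real `b` above the dual value reduces the claim to the real-valued least upper
    -- bound.
    refine EReal.le_of_forall_lt_iff_le.1 fun b hb => ?_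
    have hb' : ∀ p ∈ admissiblePairs c m ν, ∫ x, p.1 x ∂μ ≤ b := fun p hp =>
      EReal.coe_le_coe_iff.1 ((le_iSup₂ (f := fun (p : C(X, ℝ) × C(Y, ℝ))
        (_ : p ∈ admissiblePairs c m ν) => ((∫ x, p.1 x ∂μ : ℝ) : EReal)) p hp).trans hb.le)
    refine EReal.coe_le_coe_iff.2 (hlub.2 ?_)
    rintro _ ⟨p, hp, rfl⟩
    exact hb' p fun x y => hp (x, y)
  · refine iSup₂_le fun p hp => le_iInf₂ fun π hπ => EReal.coe_le_coe_iff.2 ?_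
    have := hπ.1
    obtain ⟨h1, h2⟩ := (mem_transportPlans_iff hm hm0).1 hπ
    have h := hplan π p
    rw [h1, h2, add_zero] at h
    rw [← h]
    exact integral_mono (integrable_of_continuous (dualConstraint m' ν p).continuous)
      (integrable_of_continuous hc) fun z => hp z.1 z.2
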